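/- All graphs are simple and undirected. For a graph $G$ with uniformly bounded vertex degrees, let $\Delta_G$ be the bounded operator on $\ell^2(V(G))$ given by $(\Delta_G f)(x)=\sum_{y\sim x}(f(x)-f(y))$, and let $\operatorname{spec}(G)$ be its spectrum. For a vertex $x$ and an integer $k\ge 1$ let $B_k(G,x)$ be the subgraph induced on the vertices at distance at most $k$ from $x$, rooted at $x$. Two graphs of bounded degree are called equivalent if every rooted graph that is rooted-isomorphic to a ball $B_k(G,x)$ ($k\ge1$) of one of them is rooted-isomorphic to such a ball of the other. (i) If $G$ and $H$ are equivalent connected infinite graphs of bounded vertex degree, then $\operatorname{spec}(G)=\operatorname{spec}(H)$. (ii) There exist an integer $d$ and an uncountable family of connected, countably infinite graphs of vertex degree at most $d$ that are pairwise not quasi-isometric (with respect to their shortest path metrics) and all have the same spectrum. -/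

import Mathlib

open scoped ENNReal

namespace SimpleGraph

variable {V W : Type*}

/-- Every vertex of `G` has at most `d` neighbours. -/
def DegreeBound (G : SimpleGraph V) (d : ℕ) : Prop :=
  ∀ v, (G.neighborSet v).encard ≤ d

theorem DegreeBound.finite {G : SimpleGraph V} {d : ℕ} (h : G.DegreeBound d) (v : V) :
    (G.neighborSet v).Finite :=
  Set.finite_of_encard_le_coe (h v)

/-- The neighbours of `v` as a finset. -/
noncomputable def DegreeBound.nbrs {G : SimpleGraph V} {d : ℕ} (h : G.DegreeBound d) (v : V) :
    Finset V :=
  (h.finite v).toFinset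

theorem DegreeBound.mem_nbrs {G : SimpleGraph V} {d : ℕ} (h : G.DegreeBound d) {v w : V} :
    w ∈ h.nbrs v ↔ G.Adj v w := by
  simp [DegreeBound.nbrs]

theorem DegreeBound.card_nbrs_le {G : SimpleGraph V} {d : ℕ} (h : G.DegreeBound d) (v : V) :
    (h.nbrs v).card ≤ d := by
  have := h v
  rw [(h.finite v).encard_eq_coe_toFinset_card] at this
  exact_mod_cast this

theorem DegreeBound.sum_sum_le {G : SimpleGraph V} {d : ℕ} (h : G.DegreeBound d)
    (g : V → ℝ) (hg : ∀ v, 0 ≤ g v) (hs : Summable g) (s : Finset V) :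
    ∑ x ∈ s, ∑ y ∈ h.nbrs x, g y ≤ d * ∑' v, g v := by
  classical
  have h1 : ∑ x ∈ s, ∑ y ∈ h.nbrs x, g y
      = ∑ y ∈ s.biUnion h.nbrs, ∑ x ∈ (h.nbrs y).filter (· ∈ s), g y := by
    apply Finset.sum_comm'
    intro x y
    simp only [Finset.mem_biUnion, Finset.mem_filter, h.mem_nbrs]
    constructor
    · rintro ⟨hx, hxy⟩
      exact ⟨⟨hxy.symm, hx⟩, x, hx, hxy⟩
    · rintro ⟨⟨hxy, hx⟩, _⟩
      exact ⟨hx, hxy.symm⟩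
  rw [h1]
  calc _ ≤ ∑ y ∈ s.biUnion h.nbrs, (d : ℝ) * g y := by
        refine Finset.sum_le_sum fun y _ => ?_
        rw [Finset.sum_const, nsmul_eq_mul]
        refine mul_le_mul_of_nonneg_right ?_ (hg y)
        exact_mod_cast (Finset.card_filter_le _ _).trans (h.card_nbrs_le y)
    _ = d * ∑ y ∈ s.biUnion h.nbrs, g y := by rw [Finset.mul_sum]
    _ ≤ _ := mul_le_mul_of_nonneg_left (hs.sum_le_tsum _ fun v _ => hg v) (Nat.cast_nonneg d)

/-- The graph Laplacian on functions: `(Δ f)(x) = ∑_{y ∼ x} (f(x) - f(y))`. -/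
noncomputable def DegreeBound.lapFun {G : SimpleGraph V} {d : ℕ} (h : G.DegreeBound d)
    (f : V → ℂ) (x : V) : ℂ :=
  ∑ y ∈ h.nbrs x, (f x - f y)

theorem DegreeBound.lapFun_sq_le {G : SimpleGraph V} {d : ℕ} (h : G.DegreeBound d)
    (f : V → ℂ) (x : V) :
    ‖h.lapFun f x‖ ^ 2 ≤ 2 * d * (d * ‖f x‖ ^ 2 + ∑ y ∈ h.nbrs x, ‖f y‖ ^ 2) := by
  have hc : ((h.nbrs x).card : ℝ) ≤ d := by exact_mod_cast h.card_nbrs_le x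
  calc ‖h.lapFun f x‖ ^ 2 ≤ (∑ y ∈ h.nbrs x, ‖f x - f y‖) ^ 2 := by
        gcongr
        exact norm_sum_le _ _
    _ ≤ (h.nbrs x).card * ∑ y ∈ h.nbrs x, ‖f x - f y‖ ^ 2 := sq_sum_le_card_mul_sum_sq
    _ ≤ d * ∑ y ∈ h.nbrs x, (2 * ‖f x‖ ^ 2 + 2 * ‖f y‖ ^ 2) := by
        gcongr with y
        have := norm_sub_le (f x) (f y)
        nlinarith [norm_nonneg (f x - f y), sq_nonneg (‖f x‖ - ‖f y‖)]
    _ = d * ((h.nbrs x).card * (2 * ‖f x‖ ^ 2) + 2 * ∑ y ∈ h.nbrs x, ‖f y‖ ^ 2) := by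
        rw [Finset.sum_add_distrib, Finset.sum_const, nsmul_eq_mul, Finset.mul_sum]
    _ ≤ d * (d * (2 * ‖f x‖ ^ 2) + 2 * ∑ y ∈ h.nbrs x, ‖f y‖ ^ 2) := by gcongr
    _ = _ := by ring

theorem DegreeBound.sum_lapFun_sq_le {G : SimpleGraph V} {d : ℕ} (h : G.DegreeBound d)
    (f : lp (fun _ : V => ℂ) 2) (s : Finset V) :
    ∑ x ∈ s, ‖h.lapFun f x‖ ^ 2 ≤ (2 * d * ‖f‖) ^ 2 := by
  have hf : HasSum (fun v => ‖f v‖ ^ 2) (‖f‖ ^ 2) := by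
    have := lp.hasSum_norm (p := 2) (by norm_num) f
    simpa using this
  have h1 := h.sum_sum_le (fun v => ‖f v‖ ^ 2) (fun v => by positivity) hf.summable s
  rw [hf.tsum_eq] at h1
  have h2 : ∑ x ∈ s, ‖f x‖ ^ 2 ≤ ‖f‖ ^ 2 := sum_le_hasSum s (fun v _ => by positivity) hf
  calc ∑ x ∈ s, ‖h.lapFun f x‖ ^ 2
      ≤ ∑ x ∈ s, 2 * d * (d * ‖f x‖ ^ 2 + ∑ y ∈ h.nbrs x, ‖f y‖ ^ 2) :=
        Finset.sum_le_sum fun x _ => h.lapFun_sq_le f x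
    _ = 2 * d * (d * ∑ x ∈ s, ‖f x‖ ^ 2 + ∑ x ∈ s, ∑ y ∈ h.nbrs x, ‖f y‖ ^ 2) := by
        rw [← Finset.mul_sum, Finset.sum_add_distrib, ← Finset.mul_sum]
    _ ≤ 2 * d * (d * ‖f‖ ^ 2 + d * ‖f‖ ^ 2) := by gcongr
    _ = _ := by ring

theorem DegreeBound.memℓp_lapFun {G : SimpleGraph V} {d : ℕ} (h : G.DegreeBound d)
    (f : lp (fun _ : V => ℂ) 2) : Memℓp (h.lapFun f) 2 := by
  refine memℓp_gen' (C := (2 * d * ‖f‖) ^ 2) fun s => ?_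
  simpa using h.sum_lapFun_sq_le f s

/-- The graph Laplacian as a bounded operator on the complex Hilbert space `ℓ²(V)`. -/
noncomputable def DegreeBound.laplacian {G : SimpleGraph V} {d : ℕ} (h : G.DegreeBound d) :
    lp (fun _ : V => ℂ) 2 →L[ℂ] lp (fun _ : V => ℂ) 2 :=
  LinearMap.mkContinuous
    { toFun := fun f => ⟨h.lapFun f, h.memℓp_lapFun f⟩
      map_add' := fun f g => by
        ext x
        change ∑ y ∈ h.nbrs x, ((f x + g x) - (f y + g y))
          = ∑ y ∈ h.nbrs x, (f x - f y) + ∑ y ∈ h.nbrs x, (g x - g y)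
        rw [← Finset.sum_add_distrib]
        exact Finset.sum_congr rfl fun y _ => by ring
      map_smul' := fun c f => by
        ext x
        change ∑ y ∈ h.nbrs x, (c * f x - c * f y) = c * ∑ y ∈ h.nbrs x, (f x - f y)
        rw [Finset.mul_sum]
        exact Finset.sum_congr rfl fun y _ => by ring }
    (2 * d)
    (fun f => lp.norm_le_of_forall_sum_le (p := 2) (by norm_num) (by positivity) fun s => by
      simpa using h.sum_lapFun_sq_le f s)

theorem DegreeBound.laplacian_apply {G : SimpleGraph V} {d : ℕ} (h : G.DegreeBound d)
    (f : lp (fun _ : V => ℂ) 2) (x : V) :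
    h.laplacian f x = ∑ y ∈ h.nbrs x, (f x - f y) :=
  rfl

/-- The spectrum of the graph Laplacian on `ℓ²(V)`. -/
noncomputable def DegreeBound.spec {G : SimpleGraph V} {d : ℕ} (h : G.DegreeBound d) : Set ℂ :=
  spectrum ℂ h.laplacian

/-- The vertex set of the ball of radius `k` around `x` in the shortest path distance
(vertices in other components have infinite distance from `x`). -/
def vertexBall (G : SimpleGraph V) (k : ℕ) (x : V) : Set V :=
  {y | G.edist x y ≤ k}

theorem mem_vertexBall_self (G : SimpleGraph V) (k : ℕ) (x : V) : x ∈ G.vertexBall k x := by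
  simp [vertexBall]

/-- A graph with a distinguished vertex. -/
structure RootedGraph where
  /-- the vertex set -/
  Vert : Type
  /-- the graph -/
  graph : SimpleGraph Vert
  /-- the distinguished vertex -/
  root : Vert

/-- The rooted graph `B` is rooted-isomorphic to the ball of radius `k` around `x` in `G`
(the subgraph induced on the vertex ball, rooted at `x`). -/
def IsBallAt (G : SimpleGraph V) (k : ℕ) (x : V) (B : RootedGraph) : Prop :=
  ∃ e : G.induce (G.vertexBall k x) ≃g B.graph, e ⟨x, G.mem_vertexBall_self k x⟩ = B.root

/-- All rooted graphs that are rooted-isomorphic to a ball of radius `k ≥ 1` in `G`. -/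
def rootedBalls (G : SimpleGraph V) : Set RootedGraph :=
  {B | ∃ (x : V) (k : ℕ), 1 ≤ k ∧ G.IsBallAt k x B}

/-- Two graphs are equivalent if they have the same rooted balls up to rooted isomorphism. -/
def BallEquivalent (G : SimpleGraph V) (H : SimpleGraph W) : Prop :=
  G.rootedBalls = H.rootedBalls

/-- Two connected graphs are quasi-isometric, with respect to their shortest path metrics. -/
def QuasiIsometric (G : SimpleGraph V) (H : SimpleGraph W) : Prop :=
  ∃ (f : V → W) (A B C : ℝ), 1 ≤ A ∧ 0 ≤ B ∧ 0 ≤ C ∧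
    (∀ x y, (G.dist x y : ℝ) / A - B ≤ H.dist (f x) (f y) ∧
      (H.dist (f x) (f y) : ℝ) ≤ A * G.dist x y + B) ∧
    ∀ w, ∃ v, (H.dist w (f v) : ℝ) ≤ C

end SimpleGraph

/-! (i) is Weyl's criterion plus locality. Let `z` lie in the spectrum of `G` but not of `H`. Then
`Δ_H - z` is bounded below by some `C > 0`, while some finitely supported `f` on `G` satisfies
`‖(Δ_G - z) f‖ < C ‖f‖`. Both norms depend only on a ball containing the support of `f` and its
neighbours. That ball also occurs in `H`, so `f` can be moved there without changing either norm
(`exists_transplant`), a contradiction.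

(ii) uses the subgraphs of the square grid induced on `0 ≤ y ≤ x ^ α`, for `0 < α < 1`. Each
contains arbitrarily large squares. Plane waves cut off to such squares are approximate
eigenfunctions for every value in `[0, 8]`, since the error lives near the boundary of the square;
degree at most 4 confines the spectrum to `[0, 8]` (`spec_comap_gridGraph`). So the spectrum does
not depend on `α`. Balls of radius `n` grow like `n ^ (1 + α)`, and a quasi-isometry preserves this
growth up to constants, so different exponents are told apart (`mul_rpow_le_of_quasiIsometric`). -/

/-! ### Approximate eigenvectors -/

/-- Weyl's criterion for normal operators, tested on a dense set of vectors. -/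
theorem ContinuousLinearMap.exists_norm_lt_of_mem_spectrum {E : Type*} [NormedAddCommGroup E]
    [InnerProductSpace ℂ E] [CompleteSpace E] {T : E →L[ℂ] E} [IsStarNormal T] {z : ℂ}
    (hz : z ∈ spectrum ℂ T) {D : Set E} (hD : Dense D) {ε : ℝ} (hε : 0 < ε) :
    ∃ f ∈ D, ‖T f - z • f‖ < ε * ‖f‖ := by
  by_contra! h
  have hall : ∀ f, ε * ‖f‖ ≤ ‖T f - z • f‖ := fun f =>
    (isClosed_le (by fun_prop) (by fun_prop) :
      IsClosed {f | ε * ‖f‖ ≤ ‖T f - z • f‖}).closure_subset_iff.2 (fun f hf => h f hf) (hD f)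
  refine hz ?_
  rw [spectrum.mem_resolventSet_iff, ← IsUnit.neg_iff, neg_sub]
  set S : E →L[ℂ] E := T - algebraMap ℂ (E →L[ℂ] E) z with hS
  have hSf : ∀ f, S f = T f - z • f := fun f => by simp [hS, Algebra.algebraMap_eq_smul_one]
  have hN : IsStarNormal S := by
    have hTT := star_comm_self' T
    constructor
    rw [commute_iff_eq, hS, star_sub, ← algebraMap_star_comm, sub_mul, sub_mul, mul_sub, mul_sub,
      mul_sub, mul_sub, hTT, Algebra.commutes z (star T),
      Algebra.commutes (star z) T, Algebra.commutes (star z) (algebraMap ℂ (E →L[ℂ] E) z)]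
    abel
  have hanti : AntilipschitzWith (Real.toNNReal ε)⁻¹ S := by
    refine S.antilipschitz_of_bound fun f => ?_
    rw [hSf]
    have h1 := hall f
    rw [NNReal.coe_inv, Real.coe_toNNReal ε hε.le, inv_mul_eq_div, le_div_iff₀ hε]
    linarith
  rw [ContinuousLinearMap.isUnit_iff_bijective,
    ContinuousLinearMap.bijective_iff_dense_range_and_antilipschitz]
  refine ⟨?_, _, hanti⟩
  -- For normal `S` the orthogonal complement of the range is the kernel, which is trivial because
  -- `S` is bounded below; hence the range is dense.
  have h2 := ContinuousLinearMap.IsStarNormal.orthogonal_range hN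
  rw [LinearMap.ker_eq_bot.2 hanti.injective] at h2
  rwa [← Submodule.topologicalClosure_eq_top_iff] at h2

theorem lp.dense_setOf_finite_support (V : Type*) :
    Dense {f : lp (fun _ : V => ℂ) 2 | (Function.support f).Finite} := by
  classical
  intro f
  refine mem_closure_of_tendsto (lp.hasSum_single (by simp) f) (Filter.Eventually.of_forall ?_)
  intro s
  refine s.finite_toSet.subset fun v hv => ?_
  by_contra hvs
  apply hv
  simp only [lp.coeFn_sum, Finset.sum_apply, lp.coeFn_single]
  refine Finset.sum_eq_zero fun i hi => Pi.single_eq_of_ne ?_ _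
  rintro rfl
  exact hvs hi

theorem lp.memℓp_of_finite_support {V : Type*} {f : V → ℂ} (hf : (Function.support f).Finite) :
    Memℓp f 2 :=
  (memℓp_zero hf).of_exponent_ge (by simp)

/-! ### Self-adjointness of the Laplacian and bounds on its spectrum -/

namespace SimpleGraph

variable {V W : Type*} {G : SimpleGraph V} {d : ℕ}

theorem DegreeBound.laplacian_single [DecidableEq V] (h : G.DegreeBound d) (v : V) :
    h.laplacian (lp.single 2 v 1)
      = ((h.nbrs v).card : ℂ) • lp.single 2 v 1 - ∑ w ∈ h.nbrs v, lp.single 2 w (1 : ℂ) := by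
  ext x
  rw [h.laplacian_apply, Finset.sum_sub_distrib, Finset.sum_const]
  simp only [lp.coeFn_sub, lp.coeFn_smul, lp.coeFn_sum, lp.coeFn_single, Pi.sub_apply,
    Pi.smul_apply, Finset.sum_apply, Pi.single_apply, Finset.sum_ite_eq]
  by_cases hx : x = v
  · subst hx; simp [h.mem_nbrs]
  · have : v ∈ h.nbrs x ↔ x ∈ h.nbrs v := by rw [h.mem_nbrs, h.mem_nbrs, G.adj_comm]
    simp [hx, this]

/-- Pairing with the unit vector at `v` reads off the value at `v`, so the adjoint is determined by
`Δ` on unit vectors. -/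
theorem DegreeBound.isSelfAdjoint_laplacian (h : G.DegreeBound d) :
    IsSelfAdjoint h.laplacian := by
  classical
  rw [ContinuousLinearMap.isSelfAdjoint_iff']
  ext f v
  have h1 : inner ℂ (lp.single 2 v (1 : ℂ)) (h.laplacian.adjoint f)
      = inner ℂ (h.laplacian (lp.single 2 v 1)) f := by
    rw [ContinuousLinearMap.adjoint_inner_right]
  rw [h.laplacian_single, inner_sub_left, sum_inner, inner_smul_left] at h1
  simp only [lp.inner_single_left] at h1
  rw [h.laplacian_apply, Finset.sum_sub_distrib, Finset.sum_const]
  simpa using h1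

theorem DegreeBound.exists_of_mem_spec (h : G.DegreeBound d) {z : ℂ} (hz : z ∈ h.spec) {ε : ℝ}
    (hε : 0 < ε) : ∃ f : lp (fun _ : V => ℂ) 2, (Function.support f).Finite ∧
      ‖h.laplacian f - z • f‖ < ε * ‖f‖ :=
  have := h.isSelfAdjoint_laplacian.isStarNormal
  ContinuousLinearMap.exists_norm_lt_of_mem_spectrum hz (lp.dense_setOf_finite_support V) hε

theorem DegreeBound.exists_le_of_notMem_spec (h : G.DegreeBound d) {z : ℂ} (hz : z ∉ h.spec) :
    ∃ C : ℝ, 0 < C ∧ ∀ f : lp (fun _ : V => ℂ) 2, C * ‖f‖ ≤ ‖h.laplacian f - z • f‖ := by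
  rw [spec, spectrum.mem_iff, not_not] at hz
  obtain ⟨u, hu⟩ := hz
  set K := ‖(↑u⁻¹ : lp (fun _ : V => ℂ) 2 →L[ℂ] lp (fun _ : V => ℂ) 2)‖ with hK
  have hK0 : 0 ≤ K := norm_nonneg _
  -- Adding one keeps the constant positive even on the zero space, where the inverse has norm zero.
  refine ⟨(K + 1)⁻¹, by positivity, fun f => ?_⟩
  rw [inv_mul_le_iff₀ (by positivity)]
  have h1 : (↑u⁻¹ : lp (fun _ : V => ℂ) 2 →L[ℂ] lp (fun _ : V => ℂ) 2)
      ((↑u : lp (fun _ : V => ℂ) 2 →L[ℂ] lp (fun _ : V => ℂ) 2) f) = f := by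
    rw [← mul_apply_eq_comp, Units.inv_mul, one_apply_eq_self]
  have h2 : ‖(↑u : lp (fun _ : V => ℂ) 2 →L[ℂ] lp (fun _ : V => ℂ) 2) f‖
      = ‖h.laplacian f - z • f‖ := by
    rw [hu, norm_sub_rev]
    simp [Algebra.algebraMap_eq_smul_one]
  calc ‖f‖ ≤ K * ‖h.laplacian f - z • f‖ := by
        rw [← h2]
        conv_lhs => rw [← h1]
        exact ContinuousLinearMap.le_opNorm _ _
    _ ≤ _ := by gcongr; linarith

theorem DegreeBound.norm_laplacian_le (h : G.DegreeBound d) : ‖h.laplacian‖ ≤ 2 * d :=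
  LinearMap.mkContinuous_norm_le _ (by positivity) _

/-- Double counting of adjacent pairs: each pair on the left with `y ∈ s` reappears on the right
with its ends exchanged, and `y ∉ s` contributes zero. -/
theorem DegreeBound.sum_sum_nbrs_le (h : G.DegreeBound d) (g : V → ℝ) (hg : ∀ v, 0 ≤ g v)
    (s : Finset V) (hs : ∀ v ∉ s, g v = 0) :
    ∑ x ∈ s, ∑ y ∈ h.nbrs x, g y ≤ ∑ x ∈ s, ∑ _y ∈ h.nbrs x, g x := by
  classical
  have h1 : ∀ x, ∑ y ∈ h.nbrs x, g y = ∑ y ∈ s, if G.Adj x y then g y else 0 := by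
    intro x
    rw [← Finset.sum_filter]
    refine (Finset.sum_subset ?_ ?_).symm
    · intro y hy
      exact h.mem_nbrs.2 (Finset.mem_filter.1 hy).2
    · intro y hy hy'
      apply hs
      intro hys
      exact hy' (Finset.mem_filter.2 ⟨hys, h.mem_nbrs.1 hy⟩)
  simp only [h1]
  rw [Finset.sum_comm]
  refine Finset.sum_le_sum fun y _ => ?_
  rw [← Finset.sum_filter]
  refine Finset.sum_le_sum_of_subset_of_nonneg ?_ fun _ _ _ => hg y
  intro x hx
  exact h.mem_nbrs.2 (Finset.mem_filter.1 hx).2.symm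

/-- Each edge term satisfies `Re ⟨a, a - b⟩ ≥ (‖a‖² - ‖b‖²) / 2`, and the sum of these lower bounds
is nonnegative by `sum_sum_nbrs_le`. -/
theorem DegreeBound.re_inner_laplacian_nonneg (h : G.DegreeBound d)
    (f : lp (fun _ : V => ℂ) 2) (hf : (Function.support f).Finite) :
    0 ≤ (inner ℂ f (h.laplacian f)).re := by
  have hsum : inner ℂ f (h.laplacian f)
      = ∑ x ∈ hf.toFinset, inner ℂ (f x) (h.laplacian f x) := by
    rw [lp.inner_eq_tsum]
    refine tsum_eq_sum fun x hx => ?_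
    have : f x = 0 := by simpa using hx
    simp [this]
  have hre : ∀ a b : ℂ, (‖a‖ ^ 2 - ‖b‖ ^ 2) / 2 ≤ (inner ℂ a (a - b)).re := by
    intro a b
    rw [Complex.sq_norm, Complex.sq_norm, Complex.normSq_apply, Complex.normSq_apply]
    simp
    nlinarith [sq_nonneg (a.re - b.re), sq_nonneg (a.im - b.im)]
  have h2 := h.sum_sum_nbrs_le (fun v => ‖f v‖ ^ 2) (fun v => by positivity) hf.toFinset
    (fun v hv => by
      have : f v = 0 := by simpa using hv
      simp [this])
  rw [hsum, Complex.re_sum]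
  calc (0 : ℝ) ≤ ∑ x ∈ hf.toFinset, ∑ y ∈ h.nbrs x, (‖f x‖ ^ 2 - ‖f y‖ ^ 2) / 2 := by
        simp only [← Finset.sum_div, Finset.sum_sub_distrib] at *
        linarith
    _ ≤ _ := by
        refine Finset.sum_le_sum fun x _ => ?_
        rw [h.laplacian_apply, inner_sum, Complex.re_sum]
        exact Finset.sum_le_sum fun y _ => hre _ _

theorem DegreeBound.spec_subset (h : G.DegreeBound d) :
    h.spec ⊆ (fun t : ℝ => (t : ℂ)) '' Set.Icc 0 (2 * d) := by
  intro z hz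
  have hzr : z = z.re := h.isSelfAdjoint_laplacian.mem_spectrum_eq_re hz
  refine ⟨z.re, ⟨?_, ?_⟩, hzr.symm⟩
  · refine le_of_forall_pos_le_add fun ε hε => ?_
    obtain ⟨f, hf, hfε⟩ := h.exists_of_mem_spec hz hε
    have hf0 : 0 < ‖f‖ := by
      by_contra! hcon
      have := norm_nonneg (h.laplacian f - z • f)
      nlinarith
    have h1 := h.re_inner_laplacian_nonneg f hf
    have h2 : (inner ℂ f (h.laplacian f - z • f)).re ≤ ‖f‖ * (ε * ‖f‖) :=
      (Complex.re_le_norm _).trans ((norm_inner_le_norm _ _).trans (by gcongr))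
    rw [inner_sub_right, inner_smul_right, inner_self_eq_norm_sq_to_K, Complex.sub_re] at h2
    have h3 : (z * ((‖f‖ : ℂ)) ^ 2).re = z.re * ‖f‖ ^ 2 := by
      rw [← Complex.ofReal_pow, Complex.re_mul_ofReal]
    have h4 : 0 ≤ (z.re + ε) * ‖f‖ ^ 2 := by
      have h2' : (inner ℂ f (h.laplacian f)).re - (z * ((‖f‖ : ℂ)) ^ 2).re ≤ ‖f‖ * (ε * ‖f‖) := h2
      rw [h3] at h2'
      linarith
    exact nonneg_of_mul_nonneg_left h4 (by positivity)
  -- The norm bound on spectral values needs a nontrivial space; over the zero space the spectrum is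
  -- empty.
  · have : Nontrivial (lp (fun _ : V => ℂ) 2) := by
      by_contra hcon
      rw [not_nontrivial_iff_subsingleton] at hcon
      have : Subsingleton (lp (fun _ : V => ℂ) 2 →L[ℂ] lp (fun _ : V => ℂ) 2) :=
        ⟨fun a b => by ext1 x; exact Subsingleton.elim _ _⟩
      exact hz (isUnit_of_subsingleton _)
    exact (Complex.re_le_norm z).trans ((spectrum.norm_le_norm_of_mem hz).trans h.norm_laplacian_le)

end SimpleGraph

/-! ### Moving finitely supported functions between graphs -/

theorem lp.norm_eq_of_injective {V W B : Type*} {i : B → V} {j : B → W}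
    (hi : Function.Injective i) (hj : Function.Injective j) (f : lp (fun _ : V => ℂ) 2)
    (g : lp (fun _ : W => ℂ) 2) (hf : ∀ v ∉ Set.range i, f v = 0)
    (hg : ∀ w ∉ Set.range j, g w = 0) (hfg : ∀ b, f (i b) = g (j b)) : ‖f‖ = ‖g‖ := by
  have h1 : ‖f‖ ^ 2 = ∑' v, ‖f v‖ ^ 2 := by
    simpa using lp.norm_rpow_eq_tsum (p := 2) (by norm_num) f
  have h2 : ‖g‖ ^ 2 = ∑' v, ‖g v‖ ^ 2 := by
    simpa using lp.norm_rpow_eq_tsum (p := 2) (by norm_num) g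
  rw [← pow_left_inj₀ (norm_nonneg _) (norm_nonneg _) two_ne_zero, h1, h2, ← hi.tsum_eq,
    ← hj.tsum_eq]
  · simp only [hfg]
  · intro w hw
    by_contra h
    exact hw (by simp [hg w h])
  · intro v hv
    by_contra h
    exact hv (by simp [hf v h])

namespace SimpleGraph

variable {V W : Type*} {G : SimpleGraph V} {H : SimpleGraph W} {d : ℕ}

section Transplant

variable {B : Type*} {i : B → V} {j : B → W} {f : V → ℂ}

/-- Only adjacency between indexed points enters the right side, so it can be compared across two
graphs sharing the index type. A neighbour outside the range of `i` can occur only where `f (i b) =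
0`, and then contributes `0 - 0`. -/
theorem DegreeBound.lapFun_eq_tsum (hG : G.DegreeBound d) (hi : Function.Injective i)
    (hf : ∀ v ∉ Set.range i, f v = 0)
    (hnb : ∀ b, f (i b) ≠ 0 → ∀ v, G.Adj (i b) v → v ∈ Set.range i) (b : B) :
    hG.lapFun f (i b)
      = ∑' c, Set.indicator {c | G.Adj (i b) (i c)} (fun c => f (i b) - f (i c)) c := by
  classical
  have h1 : hG.lapFun f (i b)
      = ∑' v, Set.indicator {v | G.Adj (i b) v} (fun v => f (i b) - f v) v := by
    rw [lapFun, tsum_eq_sum (s := hG.nbrs (i b))]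
    · refine Finset.sum_congr rfl fun v hv => ?_
      exact (Set.indicator_of_mem (s := {v | G.Adj (i b) v}) (hG.mem_nbrs.1 hv)
        fun v => f (i b) - f v).symm
    · intro v hv
      exact Set.indicator_of_notMem (fun h => hv (hG.mem_nbrs.2 h)) _
  rw [h1, ← hi.tsum_eq]
  · rfl
  · intro v hv
    have hadj : G.Adj (i b) v := Set.mem_of_indicator_ne_zero hv
    by_contra hvi
    have hfv := hf v hvi
    rw [Function.mem_support,
      Set.indicator_of_mem (show v ∈ {v | G.Adj (i b) v} from hadj), hfv, sub_zero] at hv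
    exact hvi (hnb b hv v hadj)

theorem DegreeBound.lapFun_eq_zero (hG : G.DegreeBound d)
    (hf : ∀ v ∉ Set.range i, f v = 0)
    (hnb : ∀ b, f (i b) ≠ 0 → ∀ v, G.Adj (i b) v → v ∈ Set.range i) {v : V}
    (hv : v ∉ Set.range i) : hG.lapFun f v = 0 := by
  refine Finset.sum_eq_zero fun y hy => ?_
  rw [hG.mem_nbrs] at hy
  rw [hf v hv, zero_sub, neg_eq_zero]
  by_contra h
  have hyr : y ∈ Set.range i := by
    by_contra h'
    exact h (hf y h')
  obtain ⟨b, rfl⟩ := hyr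
  exact hv (hnb b h v hy.symm)

/-- A function on `V` supported in a set isomorphic to a subset of `W`, with all the neighbours of
its support, can be moved to `W` without changing its norm and that of its image under
`Δ - z`. -/
theorem DegreeBound.exists_transplant (hG : G.DegreeBound d) (hH : H.DegreeBound d)
    (hi : Function.Injective i) (hj : Function.Injective j)
    (hadj : ∀ b c, G.Adj (i b) (i c) ↔ H.Adj (j b) (j c))
    (f : lp (fun _ : V => ℂ) 2) (hfin : (Function.support f).Finite)
    (hf : ∀ v ∉ Set.range i, f v = 0)
    (hnG : ∀ b, f (i b) ≠ 0 → ∀ v, G.Adj (i b) v → v ∈ Set.range i)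
    (hnH : ∀ b, f (i b) ≠ 0 → ∀ w, H.Adj (j b) w → w ∈ Set.range j) (z : ℂ) :
    ∃ g : lp (fun _ : W => ℂ) 2, ‖g‖ = ‖f‖ ∧
      ‖hH.laplacian g - z • g‖ = ‖hG.laplacian f - z • f‖ := by
  classical
  set F : W → ℂ := Function.extend j (f ∘ i) 0 with hF
  have hFj : ∀ b, F (j b) = f (i b) := fun b => hj.extend_apply _ _ b
  have hF0 : ∀ w ∉ Set.range j, F w = 0 := fun w hw =>
    Function.extend_apply' _ _ _ hw
  have hFfin : (Function.support F).Finite := by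
    refine ((hfin.preimage hi.injOn).image j).subset fun w hw => ?_
    have hwr : w ∈ Set.range j := by
      by_contra h
      exact hw (hF0 w h)
    obtain ⟨b, rfl⟩ := hwr
    exact ⟨b, by rwa [Function.mem_support, hFj] at hw, rfl⟩
  have hnH' : ∀ b, F (j b) ≠ 0 → ∀ w, H.Adj (j b) w → w ∈ Set.range j := by
    intro b hb
    exact hnH b (by rwa [hFj] at hb)
  let g : lp (fun _ : W => ℂ) 2 := ⟨F, lp.memℓp_of_finite_support hFfin⟩
  refine ⟨g, (lp.norm_eq_of_injective hi hj f g hf hF0 fun b => (hFj b).symm).symm, ?_⟩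
  refine (lp.norm_eq_of_injective hi hj _ _ ?_ ?_ ?_).symm
  · intro v hv
    change hG.lapFun f v - z * f v = 0
    rw [hG.lapFun_eq_zero hf hnG hv, hf v hv, mul_zero, sub_zero]
  · intro w hw
    change hH.lapFun F w - z * F w = 0
    rw [hH.lapFun_eq_zero hF0 hnH' hw, hF0 w hw, mul_zero, sub_zero]
  · intro b
    change hG.lapFun f (i b) - z * f (i b) = hH.lapFun F (j b) - z * F (j b)
    rw [hG.lapFun_eq_tsum hi hf hnG, hH.lapFun_eq_tsum hj hF0 hnH', hFj]
    simp only [hFj, hadj]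

end Transplant

/-! ### Balls and equivalent graphs -/

/-- A shortest path from the root stays inside the ball, so its image is a walk of the same length.
-/
theorem edist_le_of_ball_hom {k k' : ℕ} {x : V} {y : W}
    (e : G.induce (G.vertexBall k x) →g H.induce (H.vertexBall k' y))
    (he : e ⟨x, G.mem_vertexBall_self k x⟩ = ⟨y, H.mem_vertexBall_self k' y⟩)
    (v : G.vertexBall k x) : H.edist y (e v) ≤ G.edist x v := by
  classical
  obtain ⟨v, hv⟩ := v
  have hv' : G.edist x v ≤ k := hv
  obtain ⟨p, hp⟩ := G.exists_walk_of_edist_ne_top (ne_top_of_le_ne_top (ENat.natCast_ne_top k) hv')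
  have hs : ∀ u ∈ p.support, u ∈ G.vertexBall k x := by
    intro u hu
    refine (G.edist_le (p.takeUntil u hu)).trans (le_trans ?_ hv')
    rw [← hp]
    exact_mod_cast p.length_takeUntil_le_length hu
  have hlen : (p.induce _ hs).length = p.length  :=
    (Walk.length_map _ _).symm.trans (congrArg Walk.length (p.map_induce hs))
  have h1 := edist_le (((p.induce _ hs).map e).map (Embedding.induce _).toHom)
  rw [Walk.length_map, Walk.length_map, hlen, hp] at h1
  change H.edist (e ⟨x, G.mem_vertexBall_self k x⟩ : W) _ ≤ _ at h1
  rw [he] at h1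
  exact h1

theorem DegreeBound.finite_vertexBall (hG : G.DegreeBound d) (k : ℕ) (x : V) :
    (G.vertexBall k x).Finite := by
  induction k with
  | zero =>
    refine (Set.finite_singleton x).subset fun y hy => ?_
    have : G.edist x y ≤ 0 := by exact_mod_cast hy
    exact (edist_eq_zero_iff.1 (nonpos_iff_eq_zero.1 this)).symm
  | succ k ih =>
    refine (ih.union (ih.biUnion fun y _ => hG.finite y)).subset fun y hy => ?_
    have hy' : G.edist x y ≤ (k + 1 : ℕ) := hy
    obtain ⟨p, hp⟩ := G.exists_walk_of_edist_ne_top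
      (ne_top_of_le_ne_top (ENat.natCast_ne_top _) hy')
    rw [← hp] at hy'
    have hpk : p.length ≤ k + 1 := by exact_mod_cast hy'
    rcases Nat.lt_or_ge p.length (k + 1) with hlt | hge
    · left
      refine (edist_le p).trans ?_
      exact_mod_cast Nat.lt_succ_iff.1 hlt
    · right
      have hnil : ¬ p.Nil := by
        rw [Walk.not_nil_iff_lt_length]
        omega
      have hpen := p.adj_penultimate hnil
      refine Set.mem_biUnion (x := p.penultimate) ?_ hpen
      refine (edist_le p.dropLast).trans ?_
      rw [Walk.length_dropLast]
      exact_mod_cast (by omega : p.length - 1 ≤ k)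

/-- Balls are finite, so some vertex lies outside the ball of radius `k`; the `k`-th vertex of a
shortest path to it is at distance exactly `k`. -/
theorem Connected.exists_edist_eq [Infinite V] (hc : G.Connected) (hG : G.DegreeBound d) (k : ℕ)
    (x : V) : ∃ v, G.edist x v = k := by
  obtain ⟨v, hv⟩ := (hG.finite_vertexBall k x).exists_notMem
  obtain ⟨p, hp⟩ := hc.exists_walk_length_eq_edist x v
  have hk : k < p.length := by
    by_contra! h
    exact hv (hp.ge.trans (by exact_mod_cast h))
  refine ⟨p.getVert k, le_antisymm ?_ ?_⟩
  · refine (edist_le (p.take k)).trans ?_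
    rw [Walk.take_length]
    exact_mod_cast min_le_left _ _
  · have h1 : G.edist x v ≤ G.edist x (p.getVert k) + G.edist (p.getVert k) v :=
      SimpleGraph.edist_triangle ..
    have h2 : G.edist (p.getVert k) v ≤ (p.length - k : ℕ) := by
      refine (edist_le (p.drop k)).trans ?_
      rw [Walk.drop_length]
    rw [← hp] at h1
    by_contra! hlt
    obtain ⟨m, hm⟩ := ENat.ne_top_iff_exists.1 (ne_top_of_lt hlt)
    rw [← hm] at hlt h1
    have h3 : (p.length : ℕ∞) ≤ (m : ℕ∞) + (p.length - k : ℕ) := h1.trans (by gcongr)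
    have h4 : p.length ≤ m + (p.length - k) := by exact_mod_cast h3
    have h5 : m < k := by exact_mod_cast hlt
    omega

theorem mem_vertexBall_succ_of_adj {k : ℕ} {x v w : V} (hv : G.edist x v ≤ k) (hvw : G.Adj v w) :
    w ∈ G.vertexBall (k + 1) x := by
  refine (SimpleGraph.edist_triangle (v := v)).trans ?_
  push_cast
  gcongr
  exact (edist_eq_one_iff_adj.2 hvw).le

/-- A `RootedGraph` has its vertices in `Type`, whatever the universe of `V`, so the finite ball is
relabelled by `Fin n`. Equivalence gives no control on the radius `k'`. -/
theorem DegreeBound.exists_ball_iso (hG : G.DegreeBound d) (hGH : G.BallEquivalent H) (k : ℕ)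
    (hk : 1 ≤ k) (x : V) : ∃ (y : W) (k' : ℕ)
      (e : G.induce (G.vertexBall k x) ≃g H.induce (H.vertexBall k' y)),
      e ⟨x, G.mem_vertexBall_self k x⟩ = ⟨y, H.mem_vertexBall_self k' y⟩ := by
  have := (hG.finite_vertexBall k x).to_subtype
  obtain ⟨n, ⟨φ⟩⟩ := Finite.exists_equiv_fin (G.vertexBall k x)
  have hB : (⟨Fin n, (G.induce (G.vertexBall k x)).map φ,
      φ ⟨x, G.mem_vertexBall_self k x⟩⟩ : RootedGraph) ∈ G.rootedBalls :=
    ⟨x, k, hk, Iso.map φ _, rfl⟩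
  rw [hGH] at hB
  obtain ⟨y, k', -, e', he'⟩ := hB
  refine ⟨y, k', (Iso.map φ _).trans e'.symm, ?_⟩
  exact (e'.symm_apply_eq).2 he'.symm

theorem DegreeBound.spec_subset_of_ballEquivalent [Infinite V] (hG : G.DegreeBound d)
    (hH : H.DegreeBound d) (hc : G.Connected) (hGH : G.BallEquivalent H) : hG.spec ⊆ hH.spec := by
  intro z hz
  by_contra hzH
  obtain ⟨C, hC, hCH⟩ := hH.exists_le_of_notMem_spec hzH
  obtain ⟨f, hfin, hf⟩ := hG.exists_of_mem_spec hz hC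
  obtain ⟨x⟩ := hc.nonempty
  obtain ⟨k, hk⟩ : ∃ k : ℕ, ∀ v, f v ≠ 0 → G.edist x v ≤ k := by
    obtain ⟨k, hk⟩ := (hfin.image (G.dist x)).bddAbove
    refine ⟨k, fun v hv => ?_⟩
    rw [← (hc x v).coe_dist_eq_edist]
    exact_mod_cast hk ⟨v, hv, rfl⟩
  -- The extra unit of radius makes room for the neighbours of the support of `f`.
  obtain ⟨y, k', e, he⟩ := hG.exists_ball_iso hGH (k + 1) (by omega) x
  have hle := edist_le_of_ball_hom e.toHom he
  -- A vertex at distance exactly `k + 1` from `x` cannot move closer to the root, since `e.symm`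
  -- does not increase distances. Thus the ball in `H` also contains all neighbours of the moved
  -- support.
  have hk' : k + 1 ≤ k' := by
    obtain ⟨v, hv⟩ := hc.exists_edist_eq hG (k + 1) x
    have hvb : v ∈ G.vertexBall (k + 1) x := hv.le
    have h1 := edist_le_of_ball_hom e.symm.toHom (e.symm_apply_eq.2 he.symm) (e ⟨v, hvb⟩)
    have h2 : G.edist x v ≤ H.edist y (e ⟨v, hvb⟩) := by
      simpa using h1
    have h3 : H.edist y (e ⟨v, hvb⟩) ≤ k' := (e ⟨v, hvb⟩).2
    rw [hv] at h2
    exact_mod_cast h2.trans h3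
  obtain ⟨g, hg1, hg2⟩ := hG.exists_transplant hH (i := fun b : G.vertexBall (k + 1) x => (b : V))
    (j := fun b => (e b : W)) Subtype.val_injective (Subtype.val_injective.comp e.injective)
    (fun b c => (e.map_rel_iff (a := b) (b := c)).symm) f hfin
    (fun v hv => by
      by_contra h
      refine hv ⟨⟨v, (hk v h).trans ?_⟩, rfl⟩
      exact_mod_cast Nat.le_succ k)
    (fun b hb v hv => ⟨⟨v, mem_vertexBall_succ_of_adj (hk b hb) hv⟩, rfl⟩)
    (fun b hb w hw => by
      have h1 : w ∈ H.vertexBall (k + 1) y :=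
        mem_vertexBall_succ_of_adj ((hle b).trans (hk b hb)) hw
      have h2 : w ∈ H.vertexBall k' y :=
        le_trans (b := ((k + 1 : ℕ) : ℕ∞)) h1 (by exact_mod_cast hk')
      exact ⟨e.symm ⟨w, h2⟩, by simp⟩) z
  have := hCH g
  rw [hg1, hg2] at this
  exact absurd hf this.not_gt

end SimpleGraph

/-! ### Spectra of subgraphs of the square grid -/

theorem lp.norm_sq_eq_sum {V : Type*} (f : lp (fun _ : V => ℂ) 2) (s : Finset V)
    (hs : ∀ v ∉ s, f v = 0) : ‖f‖ ^ 2 = ∑ v ∈ s, ‖f v‖ ^ 2 := by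
  have h1 : ‖f‖ ^ 2 = ∑' v, ‖f v‖ ^ 2 := by
    simpa using lp.norm_rpow_eq_tsum (p := 2) (by norm_num) f
  rw [h1, tsum_eq_sum]
  intro v hv
  simp [hs v hv]

namespace SimpleGraph

/-- The square grid on `ℤ × ℤ`. -/
def gridGraph : SimpleGraph (ℤ × ℤ) where
  Adj p q := (p.1 - q.1).natAbs + (p.2 - q.2).natAbs = 1
  symm := ⟨fun p q h => by omega⟩
  loopless := ⟨fun p h => by simp at h⟩

theorem gridGraph_adj {p q : ℤ × ℤ} :
    gridGraph.Adj p q ↔ (p.1 - q.1).natAbs + (p.2 - q.2).natAbs = 1 :=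
  Iff.rfl

/-- The four neighbours of a point of the square grid. -/
def gridNbrs (q : ℤ × ℤ) : Finset (ℤ × ℤ) :=
  {(q.1 + 1, q.2), (q.1 - 1, q.2), (q.1, q.2 + 1), (q.1, q.2 - 1)}

theorem mem_gridNbrs {q r : ℤ × ℤ} : r ∈ gridNbrs q ↔ gridGraph.Adj q r := by
  obtain ⟨a, b⟩ := q
  obtain ⟨c, d⟩ := r
  simp only [gridNbrs, Finset.mem_insert, Finset.mem_singleton, Prod.mk.injEq, gridGraph_adj]
  omega

theorem sum_gridNbrs {M : Type*} [AddCommMonoid M] (F : ℤ × ℤ → M) (q : ℤ × ℤ) :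
    ∑ r ∈ gridNbrs q, F r
      = F (q.1 + 1, q.2) + (F (q.1 - 1, q.2) + (F (q.1, q.2 + 1) + F (q.1, q.2 - 1))) := by
  rw [gridNbrs, Finset.sum_insert, Finset.sum_insert, Finset.sum_insert, Finset.sum_singleton]
  all_goals
    simp only [Finset.mem_insert, Finset.mem_singleton, Prod.mk.injEq]
    omega

theorem card_gridNbrs_le (q : ℤ × ℤ) : (gridNbrs q).card ≤ 4 :=
  Finset.card_le_four

variable {V : Type*} {p : V → ℤ × ℤ}

theorem degreeBound_comap_gridGraph (hp : Function.Injective p) :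
    (gridGraph.comap p).DegreeBound 4 := by
  intro v
  rw [← hp.encard_image]
  calc (p '' (gridGraph.comap p).neighborSet v).encard ≤ (gridNbrs (p v) : Set (ℤ × ℤ)).encard := by
        refine Set.encard_le_encard ?_
        rintro _ ⟨w, hw, rfl⟩
        exact mem_gridNbrs.2 hw
    _ ≤ 4 := by
        rw [Set.encard_coe_eq_coe_finsetCard]
        exact_mod_cast card_gridNbrs_le (p v)

/-- A plane wave along the diagonal, cut off to a square. -/
noncomputable def gridWave (u : ℂ) (a : ℤ × ℤ) (L : ℕ) (q : ℤ × ℤ) : ℂ :=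
  if q ∈ Finset.Icc a.1 (a.1 + L) ×ˢ Finset.Icc a.2 (a.2 + L) then u ^ (q.1 + q.2) else 0

theorem gridWave_of_mem {u : ℂ} {a : ℤ × ℤ} {L : ℕ} {q : ℤ × ℤ}
    (h : (a.1 ≤ q.1 ∧ q.1 ≤ a.1 + L) ∧ a.2 ≤ q.2 ∧ q.2 ≤ a.2 + L) :
    gridWave u a L q = u ^ (q.1 + q.2) :=
  if_pos (by simpa [Finset.mem_product] using h)

theorem gridWave_of_notMem {u : ℂ} {a : ℤ × ℤ} {L : ℕ} {q : ℤ × ℤ}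
    (h : ¬ ((a.1 ≤ q.1 ∧ q.1 ≤ a.1 + L) ∧ a.2 ≤ q.2 ∧ q.2 ≤ a.2 + L)) :
    gridWave u a L q = 0 :=
  if_neg (by simpa only [Finset.mem_product, Finset.mem_Icc] using h)

theorem norm_gridWave_le {u : ℂ} (hu : ‖u‖ = 1) (a : ℤ × ℤ) (L : ℕ) (q : ℤ × ℤ) :
    ‖gridWave u a L q‖ ≤ 1 := by
  unfold gridWave
  split_ifs
  · rw [norm_zpow, hu, one_zpow]
  · simp

theorem image_nbrs_comap_gridGraph (h : (gridGraph.comap p).DegreeBound 4) {v : V}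
    (hv : ∀ r, gridGraph.Adj (p v) r → r ∈ Set.range p) :
    (h.nbrs v).image p = gridNbrs (p v) := by
  ext r
  rw [Finset.mem_image, mem_gridNbrs]
  constructor
  · rintro ⟨w, hw, rfl⟩
    exact h.mem_nbrs.1 hw
  · intro hr
    obtain ⟨w, rfl⟩ := hv r hr
    exact ⟨w, h.mem_nbrs.2 hr, rfl⟩

/-- Strictly inside the square all four grid neighbours are present and the cut-off is invisible;
two of them multiply the wave by `u` and two by `u⁻¹`. -/
theorem lapFun_gridWave_of_interior (hp : Function.Injective p)
    (h : (gridGraph.comap p).DegreeBound 4) {u : ℂ} (hu : u ≠ 0) {a : ℤ × ℤ} {L : ℕ}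
    (hbox : ∀ q : ℤ × ℤ, (a.1 ≤ q.1 ∧ q.1 ≤ a.1 + L) ∧ a.2 ≤ q.2 ∧ q.2 ≤ a.2 + L → q ∈ Set.range p)
    {v : V} (hv : (a.1 < (p v).1 ∧ (p v).1 < a.1 + L) ∧ a.2 < (p v).2 ∧ (p v).2 < a.2 + L) :
    h.lapFun (gridWave u a L ∘ p) v = (4 - 2 * (u + u⁻¹)) * gridWave u a L (p v) := by
  have hsum : h.lapFun (gridWave u a L ∘ p) v
      = ∑ r ∈ gridNbrs (p v), (gridWave u a L (p v) - gridWave u a L r) := by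
    rw [← image_nbrs_comap_gridGraph h, Finset.sum_image hp.injOn]
    · rfl
    · intro r hr
      rw [gridGraph_adj] at hr
      exact hbox r (by omega)
  rw [hsum, sum_gridNbrs]
  generalize p v = q at hv
  obtain ⟨x, y⟩ := q
  simp only at hv ⊢
  rw [gridWave_of_mem, gridWave_of_mem, gridWave_of_mem, gridWave_of_mem, gridWave_of_mem]
  · have e1 : x + 1 + y = x + y + 1 := by ring
    have e2 : x - 1 + y = x + y - 1 := by ring
    have e3 : x + (y + 1) = x + y + 1 := by ring
    have e4 : x + (y - 1) = x + y - 1 := by ring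
    simp only [e1, e2, e3, e4, zpow_add_one₀ hu, zpow_sub_one₀ hu]
    ring
  all_goals
    simp only
    omega

theorem norm_lapFun_gridWave_le (h : (gridGraph.comap p).DegreeBound 4) {u : ℂ} (hu : ‖u‖ = 1)
    (a : ℤ × ℤ) (L : ℕ) (v : V) : ‖h.lapFun (gridWave u a L ∘ p) v‖ ≤ 8 := by
  calc ‖h.lapFun (gridWave u a L ∘ p) v‖ ≤ ∑ _y ∈ h.nbrs v, (2 : ℝ) := by
        refine norm_sum_le_of_le _ fun y _ => ?_
        refine (norm_sub_le _ _).trans ?_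
        have h1 := norm_gridWave_le hu a L (p v)
        have h2 := norm_gridWave_le hu a L (p y)
        simp only [Function.comp_apply]
        linarith
    _ ≤ 8 := by
        rw [Finset.sum_const, nsmul_eq_mul]
        have : ((h.nbrs v).card : ℝ) ≤ 4 := by exact_mod_cast h.card_nbrs_le v
        linarith

/-- The Laplacian of a subgraph of the square grid that contains arbitrarily large squares has
the same spectrum as that of the whole grid. -/
theorem spec_comap_gridGraph (hp : Function.Injective p)
    (h : (gridGraph.comap p).DegreeBound 4)
    (hbox : ∀ L : ℕ, ∃ a : ℤ × ℤ, ∀ q : ℤ × ℤ,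
      (a.1 ≤ q.1 ∧ q.1 ≤ a.1 + L) ∧ a.2 ≤ q.2 ∧ q.2 ≤ a.2 + L → q ∈ Set.range p) :
    h.spec = (fun t : ℝ => (t : ℂ)) '' Set.Icc 0 8 := by
  refine Set.Subset.antisymm ?_ ?_
  · have := h.spec_subset
    norm_num at this
    exact this
  rintro _ ⟨t, ⟨ht0, ht8⟩, rfl⟩
  classical
  by_contra hz
  obtain ⟨C, hC, hCf⟩ := h.exists_le_of_notMem_spec hz
  -- The error has squared norm at most `2048 (L + 1)`, against `(L + 1)²` for the wave, so this `L`
  -- violates the lower bound `C`.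
  obtain ⟨L, hL⟩ := exists_nat_gt (2048 / C ^ 2)
  have hL1 : 1 ≤ L := by
    have : (0 : ℝ) < L := lt_trans (by positivity) hL
    exact_mod_cast this
  obtain ⟨a, ha⟩ := hbox L
  -- With `u = exp (iθ)` the eigenvalue is `4 - 4 cos θ`, which equals `t` for `cos θ = 1 - t / 4`;
  -- this lies in `[-1, 1]` because `0 ≤ t ≤ 8`.
  set u : ℂ := Complex.exp (Real.arccos (1 - t / 4) * Complex.I) with hu
  have hu1 : ‖u‖ = 1 := Complex.norm_exp_ofReal_mul_I _
  have hu0 : u ≠ 0 := Complex.exp_ne_zero _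
  have hut : 4 - 2 * (u + u⁻¹) = t := by
    have h1 : u + u⁻¹ = 2 * Complex.cos (Real.arccos (1 - t / 4)) := by
      rw [Complex.two_cos, hu, ← Complex.exp_neg, neg_mul]
    rw [h1, ← Complex.ofReal_cos, Real.cos_arccos (by linarith) (by linarith)]
    push_cast
    ring
  set box := Finset.Icc a.1 (a.1 + L) ×ˢ Finset.Icc a.2 (a.2 + L) with hboxdef
  set outer := Finset.Icc (a.1 - 1) (a.1 + L + 1) ×ˢ Finset.Icc (a.2 - 1) (a.2 + L + 1)
    with houter
  set inner := Finset.Ioo a.1 (a.1 + L) ×ˢ Finset.Ioo a.2 (a.2 + L) with hinner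
  set s := box.preimage p hp.injOn with hs
  have hs0 : ∀ v ∉ s, gridWave u a L (p v) = 0 := by
    intro v hv
    refine if_neg fun h' => hv ?_
    rwa [hs, Finset.mem_preimage]
  let f : lp (fun _ : V => ℂ) 2 := ⟨gridWave u a L ∘ p, lp.memℓp_of_finite_support
    (s.finite_toSet.subset fun v hv => by
      by_contra h'
      exact hv (hs0 v h'))⟩
  have hfn : ‖f‖ ^ 2 = ((L : ℝ) + 1) ^ 2 := by
    rw [lp.norm_sq_eq_sum f s hs0]
    have h1 : ∀ v ∈ s, ‖f v‖ ^ 2 = 1 := by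
      intro v hv
      rw [hs, Finset.mem_preimage] at hv
      have : f v = u ^ ((p v).1 + (p v).2) := if_pos hv
      rw [this, norm_zpow, hu1, one_zpow, one_pow]
    rw [Finset.sum_congr rfl h1, Finset.sum_const, nsmul_eq_mul, mul_one, hs,
      Finset.card_preimage, Finset.filter_true_of_mem]
    · rw [hboxdef, Finset.card_product, Int.card_Icc, Int.card_Icc]
      have e1 : (a.1 + L + 1 - a.1).toNat = L + 1 := by omega
      have e2 : (a.2 + L + 1 - a.2).toNat = L + 1 := by omega
      rw [e1, e2]
      push_cast
      ring
    · intro q hq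
      refine ha q ?_
      simpa [hboxdef, Finset.mem_product] using hq
  have hgn : ‖h.laplacian f - (t : ℂ) • f‖ ^ 2 ≤ 2048 * ((L : ℝ) + 1) := by
    have hval : ∀ v, (h.laplacian f - (t : ℂ) • f) v
        = h.lapFun (gridWave u a L ∘ p) v - t * gridWave u a L (p v) := fun v => rfl
    have hzero : ∀ v ∉ (outer \ inner).preimage p hp.injOn,
        (h.laplacian f - (t : ℂ) • f) v = 0 := by
      intro v hv
      rw [hval]
      rw [Finset.mem_preimage, Finset.mem_sdiff, not_and, not_not] at hv
      by_cases hvo : p v ∈ outer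
      · have := hv hvo
        rw [hinner, Finset.mem_product, Finset.mem_Ioo, Finset.mem_Ioo] at this
        rw [lapFun_gridWave_of_interior hp h hu0 ha this, hut, sub_self]
      · rw [houter, Finset.mem_product, Finset.mem_Icc, Finset.mem_Icc] at hvo
        rw [gridWave_of_notMem (by omega), mul_zero, sub_zero]
        refine Finset.sum_eq_zero fun y hy => ?_
        have hadj : gridGraph.Adj (p v) (p y) := h.mem_nbrs.1 hy
        rw [gridGraph_adj] at hadj
        simp only [Function.comp_apply]
        rw [gridWave_of_notMem (by omega), gridWave_of_notMem (by omega), sub_zero]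
    rw [lp.norm_sq_eq_sum _ _ hzero]
    -- The frame has `(L + 3)² - (L - 1)² = 8 (L + 1)` points. The error at each is at most `8 + 8 =
    -- 16`, whence `2048 = 8 * 16²`.
    have hcard : ((outer \ inner).preimage p hp.injOn).card ≤ 8 * (L + 1) := by
      refine (Finset.card_le_card_of_injOn p (t := outer \ inner) (fun v hv => by simpa using hv)
        hp.injOn).trans ?_
      have hsub : inner ⊆ outer := by
        intro q hq
        rw [hinner, Finset.mem_product, Finset.mem_Ioo, Finset.mem_Ioo] at hq
        rw [houter, Finset.mem_product, Finset.mem_Icc, Finset.mem_Icc]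
        omega
      rw [Finset.card_sdiff_of_subset hsub, houter, hinner, Finset.card_product,
        Finset.card_product, Int.card_Icc, Int.card_Icc, Int.card_Ioo, Int.card_Ioo]
      have e1 : (a.1 + L + 1 + 1 - (a.1 - 1)).toNat = L + 3 := by omega
      have e2 : (a.2 + L + 1 + 1 - (a.2 - 1)).toNat = L + 3 := by omega
      have e3 : (a.1 + L - a.1 - 1).toNat = L - 1 := by omega
      have e4 : (a.2 + L - a.2 - 1).toNat = L - 1 := by omega
      rw [e1, e2, e3, e4, tsub_le_iff_right]
      obtain ⟨m, hm⟩ := Nat.exists_eq_add_of_le' hL1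
      rw [hm, Nat.add_sub_cancel]
      nlinarith
    calc _ ≤ ∑ v ∈ (outer \ inner).preimage p hp.injOn, (256 : ℝ) := by
          refine Finset.sum_le_sum fun v _ => ?_
          rw [hval]
          have h1 : ‖h.lapFun (gridWave u a L ∘ p) v - t * gridWave u a L (p v)‖ ≤ 16 := by
            refine (norm_sub_le _ _).trans ?_
            have h2 := norm_lapFun_gridWave_le h hu1 a L v
            have h3 := norm_gridWave_le hu1 a L (p v)
            rw [norm_mul, Complex.norm_real, Real.norm_eq_abs, abs_of_nonneg ht0]
            nlinarith [norm_nonneg (gridWave u a L (p v))]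
          calc _ ≤ (16 : ℝ) ^ 2 := by gcongr
            _ = 256 := by norm_num
      _ ≤ 2048 * ((L : ℝ) + 1) := by
          rw [Finset.sum_const, nsmul_eq_mul]
          have : (((outer \ inner).preimage p hp.injOn).card : ℝ) ≤ 8 * ((L : ℝ) + 1) := by
            exact_mod_cast hcard
          linarith
  have h1 : (C * ‖f‖) ^ 2 ≤ ‖h.laplacian f - (t : ℂ) • f‖ ^ 2 :=
    pow_le_pow_left₀ (by positivity) (hCf f) 2
  rw [mul_pow, hfn] at h1
  rw [div_lt_iff₀ (by positivity)] at hL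
  have hL0 : (0 : ℝ) ≤ L := Nat.cast_nonneg L
  have hC2 : 0 < C ^ 2 := by positivity
  nlinarith

end SimpleGraph

/-! ### Quasi-isometries and distances in the grid -/

namespace SimpleGraph

variable {V W : Type*} {G : SimpleGraph V} {H : SimpleGraph W}

theorem QuasiIsometric.refl (G : SimpleGraph V) : G.QuasiIsometric G :=
  ⟨id, 1, 0, 0, le_rfl, le_rfl, le_rfl, fun x y => by simp, fun w => ⟨w, by simp⟩⟩

/-- A quasi-inverse `g` sends `w` to a point whose image under `f` is within `C` of `w`; the
triangle inequality in `H` then costs `2 C` per pair of points. -/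
theorem QuasiIsometric.symm (hH : H.Connected) (h : G.QuasiIsometric H) : H.QuasiIsometric G := by
  obtain ⟨f, A, B, C, hA, hB, hC, hf, hs⟩ := h
  choose g hg using hs
  have hA0 : 0 < A := by linarith
  have htri : ∀ a b c, (H.dist a c : ℝ) ≤ H.dist a b + H.dist b c := fun a b c => by
    exact_mod_cast hH.dist_triangle
  have hlow : ∀ x y, (G.dist x y : ℝ) ≤ A * (H.dist (f x) (f y) + B) := fun x y => by
    have := (hf x y).1
    rw [sub_le_iff_le_add, div_le_iff₀ hA0] at this
    linarith
  refine ⟨g, A, A * (2 * C + B), A * (C + B), hA, by positivity, by positivity, fun x y => ?_,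
    fun v => ⟨f v, ?_⟩⟩
  · have hx := hg x
    have hy := hg y
    constructor
    · have h1 := (hf (g x) (g y)).2
      have h2 := htri x (f (g x)) y
      have h3 := htri (f (g x)) (f (g y)) y
      rw [H.dist_comm (u := f (g y)) (v := y)] at h3
      rw [sub_le_iff_le_add, div_le_iff₀ hA0]
      have h4 : 2 * C + B ≤ A * (2 * C + B) * A := by
        have : 0 ≤ 2 * C + B := by positivity
        nlinarith [mul_le_mul hA hA zero_le_one hA0.le]
      linarith
    · have h2 := htri (f (g x)) x (f (g y))
      have h3 := htri x y (f (g y))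
      rw [H.dist_comm (u := f (g x)) (v := x)] at h2
      refine (hlow _ _).trans ?_
      rw [← mul_add]
      exact mul_le_mul_of_nonneg_left (by linarith) hA0.le
  · refine (hlow _ _).trans ?_
    gcongr
    exact hg (f v)

section Grid

variable {p : V → ℤ × ℤ}

theorem natAbs_add_natAbs_le_length {v w : V} (c : (gridGraph.comap p).Walk v w) :
    ((p v).1 - (p w).1).natAbs + ((p v).2 - (p w).2).natAbs ≤ c.length := by
  induction c with
  | nil => simp
  | cons hadj c ih =>
    rw [comap_adj, gridGraph_adj] at hadj
    rw [Walk.length_cons]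
    omega

theorem Connected.natAbs_add_natAbs_le_dist (hc : (gridGraph.comap p).Connected) (v w : V) :
    ((p v).1 - (p w).1).natAbs + ((p v).2 - (p w).2).natAbs ≤ (gridGraph.comap p).dist v w := by
  obtain ⟨c, hc⟩ := hc.exists_walk_length_eq_dist v w
  rw [← hc]
  exact natAbs_add_natAbs_le_length c

end Grid

/-! ### Regions under power curves -/

/-- The integer points below the graph of `x ↦ x ^ α` in the quadrant. -/
def powerRegion (α : ℝ) : Set (ℤ × ℤ) :=
  {q | 0 ≤ q.1 ∧ 0 ≤ q.2 ∧ (q.2 : ℝ) ≤ (q.1 : ℝ) ^ α}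

theorem infinite_powerRegion (α : ℝ) : (powerRegion α).Infinite := by
  refine Set.infinite_of_injective_forall_mem (f := fun n : ℕ => ((n : ℤ), (0 : ℤ))) ?_ ?_
  · intro m n h
    simpa using h
  · intro n
    refine ⟨by simp, le_rfl, ?_⟩
    simp only [Int.cast_zero]
    positivity

theorem exists_enumeration_powerRegion (α : ℝ) :
    ∃ p : ℕ → ℤ × ℤ, Function.Injective p ∧ Set.range p = powerRegion α := by
  have := (infinite_powerRegion α).to_subtype
  obtain ⟨e⟩ := nonempty_equiv_of_countable (α := ℕ) (β := powerRegion α)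
  refine ⟨fun n => e n, Subtype.val_injective.comp e.injective, ?_⟩
  rw [show (fun n => ((e n : powerRegion α) : ℤ × ℤ)) = Subtype.val ∘ e from rfl,
    e.surjective.range_comp, Subtype.range_coe]

/-- An enumeration of the points of `powerRegion α`. -/
noncomputable def powerPoint (α : ℝ) : ℕ → ℤ × ℤ :=
  (exists_enumeration_powerRegion α).choose

theorem powerPoint_injective (α : ℝ) : Function.Injective (powerPoint α) :=
  (exists_enumeration_powerRegion α).choose_spec.1

theorem range_powerPoint (α : ℝ) : Set.range (powerPoint α) = powerRegion α :=
  (exists_enumeration_powerRegion α).choose_spec.2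

theorem powerPoint_mem (α : ℝ) (n : ℕ) : powerPoint α n ∈ powerRegion α := by
  rw [← range_powerPoint]
  exact ⟨n, rfl⟩

/-- The subgraph of the square grid induced on `powerRegion α`, with vertices numbered by `ℕ`. -/
noncomputable def powerGraph (α : ℝ) : SimpleGraph ℕ :=
  gridGraph.comap (powerPoint α)

theorem degreeBound_powerGraph (α : ℝ) : (powerGraph α).DegreeBound 4 :=
  degreeBound_comap_gridGraph (powerPoint_injective α)

theorem exists_powerPoint_eq {α : ℝ} {q : ℤ × ℤ} (hq : q ∈ powerRegion α) :
    ∃ n, powerPoint α n = q := by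
  rwa [← range_powerPoint] at hq

theorem zero_mem_powerRegion (α : ℝ) : (0 : ℤ × ℤ) ∈ powerRegion α :=
  ⟨le_rfl, le_rfl, by simpa using Real.rpow_nonneg le_rfl α⟩

/-- From any point one may descend vertically to the axis and then go left to the origin without
leaving the region, so distances from the origin are at most the coordinate sum. -/
theorem exists_walk_powerGraph {α : ℝ} {o : ℕ} (ho : powerPoint α o = 0) (n : ℕ) (v : ℕ)
    (hv : (powerPoint α v).1 + (powerPoint α v).2 = n) :
    ∃ c : (powerGraph α).Walk o v, c.length = n := by
  induction n generalizing v with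
  | zero =>
    obtain ⟨h1, h2, -⟩ := powerPoint_mem α v
    have : powerPoint α v = powerPoint α o := by
      rw [ho]
      ext
      · simp only [Prod.fst_zero]; omega
      · simp only [Prod.snd_zero]; omega
    obtain rfl := powerPoint_injective α this
    exact ⟨.nil, rfl⟩
  | succ n ih =>
    obtain ⟨h1, h2, h3⟩ := powerPoint_mem α v
    obtain ⟨q, hq, hqn, hadj⟩ : ∃ q ∈ powerRegion α, q.1 + q.2 = n ∧
        gridGraph.Adj q (powerPoint α v) := by
      rcases h2.lt_or_eq with h | h
      · refine ⟨((powerPoint α v).1, (powerPoint α v).2 - 1), ⟨h1, ?_, ?_⟩, ?_, ?_⟩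
        · simp only; omega
        · push_cast; linarith
        · push_cast at hv; simp only; omega
        · rw [gridGraph_adj]; simp
      · have h0 : (0 : ℤ) ≤ (powerPoint α v).1 - 1 := by push_cast at hv; omega
        refine ⟨((powerPoint α v).1 - 1, 0), ⟨h0, le_rfl, ?_⟩, ?_, ?_⟩
        · simp only [Int.cast_zero]
          exact Real.rpow_nonneg (by exact_mod_cast h0) _
        · push_cast at hv; simp only; omega
        · rw [gridGraph_adj]; simp only; omega
    obtain ⟨w, rfl⟩ := exists_powerPoint_eq hq
    obtain ⟨c, hc⟩ := ih w hqn
    exact ⟨c.concat (show (powerGraph α).Adj w v from hadj), by rw [Walk.length_concat, hc]⟩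

theorem connected_powerGraph (α : ℝ) : (powerGraph α).Connected := by
  obtain ⟨o, ho⟩ := exists_powerPoint_eq (zero_mem_powerRegion α)
  rw [connected_iff_exists_forall_reachable]
  refine ⟨o, fun v => ?_⟩
  obtain ⟨h1, h2, -⟩ := powerPoint_mem α v
  obtain ⟨c, -⟩ := exists_walk_powerGraph ho
    ((powerPoint α v).1 + (powerPoint α v).2).toNat v (by omega)
  exact c.reachable

theorem natAbs_add_natAbs_le_dist_powerGraph (α : ℝ) (v w : ℕ) :
    ((powerPoint α v).1 - (powerPoint α w).1).natAbs +
      ((powerPoint α v).2 - (powerPoint α w).2).natAbs ≤ (powerGraph α).dist v w :=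
  (connected_powerGraph α).natAbs_add_natAbs_le_dist v w

theorem spec_powerGraph {α : ℝ} (hα : 0 < α) (h : (powerGraph α).DegreeBound 4) :
    h.spec = (fun t : ℝ => (t : ℂ)) '' Set.Icc 0 8 := by
  refine spec_comap_gridGraph (powerPoint_injective α) h fun L => ?_
  -- Since `m ^ α ≥ L`, the square of side `L` with lower left corner `(m, 0)` fits under the curve.
  obtain ⟨m, hm⟩ := (((tendsto_rpow_atTop hα).comp tendsto_natCast_atTop_atTop).eventually_ge_atTop
    (L : ℝ)).exists
  refine ⟨((m : ℤ), 0), fun q hq => ?_⟩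
  simp only at hq
  rw [range_powerPoint]
  refine ⟨by omega, by omega, ?_⟩
  calc (q.2 : ℝ) ≤ L := by exact_mod_cast (by omega : q.2 ≤ L)
    _ ≤ (m : ℝ) ^ α := hm
    _ ≤ (q.1 : ℝ) ^ α := by
      gcongr
      exact_mod_cast hq.1.1

/-! ### Growth distinguishes the exponents -/

/-- Counting the points in balls of radius `3 n` and in their images under a quasi-isometric
embedding. -/
theorem mul_rpow_le_of_quasiIsometric {α β : ℝ} (hα : 0 < α) (hα1 : α ≤ 1) (hβ : 0 < β)
    (h : (powerGraph α).QuasiIsometric (powerGraph β)) :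
    ∃ (D : ℝ) (N : ℕ), 1 ≤ D ∧ ∀ n : ℕ, 1 ≤ n →
      (n : ℝ) * (n : ℝ) ^ α ≤ (D * n + 1) * ((D * n) ^ β + 1) * N ^ 2 := by
  obtain ⟨f, A, B, C, hA, hB, -, hf, -⟩ := h
  obtain ⟨o, ho⟩ := exists_powerPoint_eq (zero_mem_powerRegion α)
  -- Points with the same image under `f` are at distance at most `A * B < N`, so residues of the
  -- coordinates modulo `N` separate them; this gives the factor `N ^ 2`.
  obtain ⟨N, hN⟩ := exists_nat_gt (A * B)
  have hN0 : 0 < N := by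
    have : (0 : ℝ) < N := lt_of_le_of_lt (by positivity) hN
    exact_mod_cast this
  set b := powerPoint β (f o) with hb
  have hb0 : (0 : ℝ) ≤ b.1 := by exact_mod_cast (powerPoint_mem β (f o)).1
  refine ⟨b.1 + 3 * A + B, N, by linarith, fun n hn => ?_⟩
  set D : ℝ := b.1 + 3 * A + B with hD
  have hn1 : (1 : ℝ) ≤ n := by exact_mod_cast hn
  have hDn : 0 ≤ D * n := by positivity
  have hnα : (n : ℝ) ^ α ≤ n := by
    conv_rhs => rw [← Real.rpow_one (n : ℝ)]
    exact Real.rpow_le_rpow_of_exponent_le hn1 hα1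
  -- This rectangle lies in the region, has at least `n * n ^ α` points, and lies within distance `2
  -- n + n ^ α ≤ 3 n` of the origin.
  set T : Finset (ℤ × ℤ) := Finset.Icc (n : ℤ) (2 * n) ×ˢ Finset.Icc 0 ⌊(n : ℝ) ^ α⌋ with hT
  have hTmem : ∀ q ∈ T, ((n : ℤ) ≤ q.1 ∧ q.1 ≤ 2 * n) ∧ 0 ≤ q.2 ∧ q.2 ≤ ⌊(n : ℝ) ^ α⌋ := by
    intro q hq
    rwa [hT, Finset.mem_product, Finset.mem_Icc, Finset.mem_Icc] at hq
  have hfloor : ⌊(n : ℝ) ^ α⌋ ≤ n := by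
    rw [← Int.floor_natCast (R := ℝ) n]
    exact Int.floor_le_floor hnα
  have hTR : ∀ q ∈ T, ∃ v, powerPoint α v = q := by
    intro q hq
    obtain ⟨⟨h1, h2⟩, h3, h4⟩ := hTmem q hq
    refine exists_powerPoint_eq ⟨by omega, h3, ?_⟩
    refine (Int.le_floor.1 h4).trans ?_
    gcongr
    exact_mod_cast h1
  choose! v hv using hTR
  have hdist : ∀ q ∈ T, ((powerGraph α).dist o (v q) : ℝ) ≤ 3 * n := by
    intro q hq
    obtain ⟨⟨h1, h2⟩, h3, h4⟩ := hTmem q hq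
    obtain ⟨c, hc⟩ := exists_walk_powerGraph ho (q.1 + q.2).toNat (v q) (by rw [hv q hq]; omega)
    have h5 := dist_le c
    have h6 : (powerGraph α).dist o (v q) ≤ 3 * n := by omega
    exact_mod_cast h6
  have himg : ∀ q ∈ T, powerPoint β (f (v q)) ∈
      Finset.Icc 0 ⌊D * n⌋ ×ˢ Finset.Icc 0 ⌊(D * n) ^ β⌋ := by
    intro q hq
    obtain ⟨h1, h2, h3⟩ := powerPoint_mem β (f (v q))
    have h4 := natAbs_add_natAbs_le_dist_powerGraph β (f o) (f (v q))
    rw [← hb] at h4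
    have h5 : (powerPoint β (f (v q))).1 ≤ b.1 + (powerGraph β).dist (f o) (f (v q)) := by
      omega
    have h6 : ((powerPoint β (f (v q))).1 : ℝ) ≤ D * n := by
      have h7 : ((powerPoint β (f (v q))).1 : ℝ) ≤ b.1 + (powerGraph β).dist (f o) (f (v q)) := by
        exact_mod_cast h5
      have h8 := (hf o (v q)).2
      have h9 : A * ((powerGraph α).dist o (v q) : ℝ) ≤ A * (3 * n) := by
        gcongr
        exact hdist q hq
      rw [hD]
      nlinarith
    rw [Finset.mem_product, Finset.mem_Icc, Finset.mem_Icc]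
    refine ⟨⟨h1, Int.le_floor.2 h6⟩, h2, Int.le_floor.2 (h3.trans ?_)⟩
    have : (0 : ℝ) ≤ (powerPoint β (f (v q))).1 := by exact_mod_cast h1
    gcongr
  have hcard : T.card ≤ ((Finset.Icc 0 ⌊D * n⌋ ×ˢ Finset.Icc 0 ⌊(D * n) ^ β⌋) ×ˢ
      (Finset.Ico 0 (N : ℤ) ×ˢ Finset.Ico 0 (N : ℤ))).card := by
    have hNz : (0 : ℤ) < N := by exact_mod_cast hN0
    refine Finset.card_le_card_of_injOn
      (fun q => (powerPoint β (f (v q)), (q.1 % (N : ℤ), q.2 % (N : ℤ)))) ?_ ?_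
    · intro q hq
      refine Finset.mem_coe.2 (Finset.mem_product.2 ⟨himg q hq, Finset.mem_product.2
        ⟨Finset.mem_Ico.2 ⟨Int.emod_nonneg _ hNz.ne', Int.emod_lt_of_pos _ hNz⟩,
          Finset.mem_Ico.2 ⟨Int.emod_nonneg _ hNz.ne', Int.emod_lt_of_pos _ hNz⟩⟩⟩)
    · intro q hq r hr hqr
      simp only [Prod.mk.injEq] at hqr
      obtain ⟨h1, h2, h3⟩ := hqr
      have h4 := powerPoint_injective β h1
      have h5 := (hf (v q) (v r)).1
      rw [h4, dist_self, Nat.cast_zero, sub_nonpos, div_le_iff₀ (by linarith)] at h5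
      have h6 : (powerGraph α).dist (v q) (v r) < N := by
        have : ((powerGraph α).dist (v q) (v r) : ℝ) < N := by linarith
        exact_mod_cast this
      have h7 := (natAbs_add_natAbs_le_dist_powerGraph α (v q) (v r)).trans_lt h6
      rw [hv q hq, hv r hr] at h7
      have key : ∀ x y : ℤ, x % (N : ℤ) = y % (N : ℤ) → (x - y).natAbs < N → x = y := by
        intro x y hxy hlt
        have h8 : (N : ℤ) ∣ x - y := 
          Int.ModEq.dvd (show y ≡ x [ZMOD N] from hxy.symm)
        have h9 := Int.eq_zero_of_abs_lt_dvd h8 (by rw [Int.abs_eq_natAbs]; exact_mod_cast hlt)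
        omega
      exact Prod.ext (key _ _ h2 (by omega)) (key _ _ h3 (by omega))
  have hTcard : (n : ℝ) * (n : ℝ) ^ α ≤ T.card := by
    rw [hT, Finset.card_product, Int.card_Icc, Int.card_Icc]
    have e1 : ((2 * n + 1 - n : ℤ).toNat : ℝ) = n + 1 := by
      rw [show (2 * n + 1 - n : ℤ).toNat = n + 1 by omega]
      push_cast
      ring
    have e2 : (n : ℝ) ^ α ≤ ((⌊(n : ℝ) ^ α⌋ + 1 - 0).toNat : ℝ) := by
      have h1 : (⌊(n : ℝ) ^ α⌋ + 1 - 0) ≤ ((⌊(n : ℝ) ^ α⌋ + 1 - 0).toNat : ℤ) := Int.self_le_toNat _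
      have h2 : ((⌊(n : ℝ) ^ α⌋ + 1 - 0 : ℤ) : ℝ) ≤ ((⌊(n : ℝ) ^ α⌋ + 1 - 0).toNat : ℝ) := by
        exact_mod_cast h1
      refine le_trans ?_ h2
      push_cast
      linarith [Int.lt_floor_add_one ((n : ℝ) ^ α)]
    push_cast [e1]
    gcongr
    linarith
  have hbd : ∀ x : ℝ, 0 ≤ x → (((Finset.Icc 0 ⌊x⌋).card : ℕ) : ℝ) ≤ x + 1 := by
    intro x hx
    rw [Int.card_Icc]
    have h1 : ((⌊x⌋ + 1 - 0).toNat : ℤ) = ⌊x⌋ + 1 := by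
      have := Int.floor_nonneg.2 hx
      omega
    have h2 : ((⌊x⌋ + 1 - 0).toNat : ℝ) = ⌊x⌋ + 1 := by exact_mod_cast h1
    rw [h2]
    linarith [Int.floor_le x]
  refine hTcard.trans ((Nat.cast_le.2 hcard).trans ?_)
  rw [Finset.card_product, Finset.card_product, Finset.card_product, Int.card_Ico]
  push_cast
  rw [show ((N : ℤ) - 0).toNat = N by omega, sq]
  gcongr
  · exact hbd _ hDn
  · exact hbd _ (by positivity)

theorem not_quasiIsometric_powerGraph_of_lt {α β : ℝ} (hα1 : α ≤ 1) (hβ : 0 < β)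
    (hβα : β < α) : ¬ (powerGraph α).QuasiIsometric (powerGraph β) := by
  intro h
  obtain ⟨D, N, hD, hn⟩ := mul_rpow_le_of_quasiIsometric (hβ.trans hβα) hα1 hβ h
  -- The counting bound would give `n ^ (α - β) ≤ 4 * D * D ^ β * N ^ 2` for every `n ≥ 1`, because
  -- each `+ 1` at most doubles its factor.
  obtain ⟨n, hnK, hn1⟩ := (((tendsto_rpow_atTop (sub_pos.2 hβα)).comp
    tendsto_natCast_atTop_atTop).eventually_gt_atTop (4 * D * D ^ β * N ^ 2)).and
      (Filter.eventually_ge_atTop 1) |>.exists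
  have hnr : (1 : ℝ) ≤ n := by exact_mod_cast hn1
  have hn0 : (0 : ℝ) < n := by linarith
  have hDn : 1 ≤ D * n := one_le_mul_of_one_le_of_one_le hD hnr
  have hDnβ : 1 ≤ (D * n) ^ β := Real.one_le_rpow hDn hβ.le
  have h1 : (n : ℝ) * (n : ℝ) ^ α ≤ n * (4 * D * D ^ β * N ^ 2 * n ^ β) :=
    calc (n : ℝ) * (n : ℝ) ^ α ≤ (D * n + 1) * ((D * n) ^ β + 1) * N ^ 2 := hn n hn1
      _ ≤ (D * n + D * n) * ((D * n) ^ β + (D * n) ^ β) * N ^ 2 := by gcongr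
      _ = n * (4 * D * D ^ β * N ^ 2 * n ^ β) := by
        rw [Real.mul_rpow (by linarith) hn0.le]
        ring
  have h2 := le_of_mul_le_mul_left h1 hn0
  have h3 : (n : ℝ) ^ α = (n : ℝ) ^ (α - β) * (n : ℝ) ^ β := by
    rw [← Real.rpow_add hn0, sub_add_cancel]
  rw [h3] at h2
  have h4 := le_of_mul_le_mul_right h2 (Real.rpow_pos_of_pos hn0 β)
  exact absurd hnK h4.not_gt

theorem not_quasiIsometric_powerGraph {α β : ℝ} (hα : α ∈ Set.Ioo (0 : ℝ) 1)
    (hβ : β ∈ Set.Ioo (0 : ℝ) 1) (hne : α ≠ β) :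
    ¬ (powerGraph α).QuasiIsometric (powerGraph β) := by
  rcases hne.lt_or_gt with h | h
  · exact fun hq => not_quasiIsometric_powerGraph_of_lt hβ.2.le hα.1 h
      (hq.symm (connected_powerGraph β))
  · exact not_quasiIsometric_powerGraph_of_lt hα.2.le hβ.1 h

theorem injOn_powerGraph : Set.InjOn powerGraph (Set.Ioo 0 1) := by
  intro α hα β hβ h
  by_contra hne
  apply not_quasiIsometric_powerGraph hα hβ hne
  rw [h]
  exact QuasiIsometric.refl _

theorem BallEquivalent.spec_eq [Infinite V] [Infinite W] {d : ℕ} (hG : G.DegreeBound d)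
    (hH : H.DegreeBound d) (hGc : G.Connected) (hHc : H.Connected) (h : G.BallEquivalent H) :
    hG.spec = hH.spec :=
  (hG.spec_subset_of_ballEquivalent hH hGc h).antisymm
    (hH.spec_subset_of_ballEquivalent hG hHc h.symm)

end SimpleGraph

theorem mainTheorem9 :
    (∀ (V W : Type*) [Infinite V] [Infinite W] (G : SimpleGraph V) (H : SimpleGraph W) (d : ℕ)
      (hG : G.DegreeBound d) (hH : H.DegreeBound d),
      G.Connected → H.Connected → G.BallEquivalent H → hG.spec = hH.spec) ∧
    ∃ (S : Set (SimpleGraph ℕ)) (d : ℕ) (hd : ∀ G ∈ S, G.DegreeBound d),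
      ¬ S.Countable ∧
      (∀ G ∈ S, G.Connected) ∧
      (∀ G (hG : G ∈ S) H (hH : H ∈ S), (hd G hG).spec = (hd H hH).spec) ∧
      (∀ G ∈ S, ∀ H ∈ S, G ≠ H → ¬ G.QuasiIsometric H) := by
  refine ⟨fun V W _ _ G H d hG hH hGc hHc h => h.spec_eq hG hH hGc hHc,
    SimpleGraph.powerGraph '' Set.Ioo 0 1, 4, ?_, ?_, ?_, ?_, ?_⟩
  · rintro _ ⟨α, -, rfl⟩
    exact SimpleGraph.degreeBound_powerGraph α
  · intro hc
    have h1 := Set.countable_of_injective_of_countable_image SimpleGraph.injOn_powerGraph hc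
    have h2 := Cardinal.mk_Ioo_real (zero_lt_one' ℝ)
    exact (Cardinal.le_aleph0_iff_set_countable.2 h1).not_gt (h2 ▸ Cardinal.aleph0_lt_continuum)
  · rintro _ ⟨α, -, rfl⟩
    exact SimpleGraph.connected_powerGraph α
  · rintro _ ⟨α, hα, rfl⟩ _ ⟨β, hβ, rfl⟩
    rw [SimpleGraph.spec_powerGraph hα.1, SimpleGraph.spec_powerGraph hβ.1]
  · rintro _ ⟨α, hα, rfl⟩ _ ⟨β, hβ, rfl⟩ hne
    exact SimpleGraph.not_quasiIsometric_powerGraph hα hβ fun h => hne (by rw [h])
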